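/- Let $n,m\ge 0$ be integers and, for $i=0,1,\dots,m$, let $q_i(x)=x^\top A_i x+2b_i^\top x+c_i$ with $A_i\in\mathbb{S}^n$ (real symmetric), $b_i\in\mathbb{R}^n$, $c_i\in\mathbb{R}$. The index $0$ is also written "obj". Put $q(x)=(q_0(x),\dots,q_m(x))\in\mathbb{R}^{1+m}$, let $e_{\mathrm{obj}}=(1,0,\dots,0)\in\mathbb{R}^{1+m}$, and for $(\gamma_{\mathrm{obj}},\gamma)\in\mathbb{R}^{1+m}$ let $A(\gamma_{\mathrm{obj}},\gamma)=\gamma_{\mathrm{obj}}A_0+\sum_{i=1}^m\gamma_iA_i$, $A[\gamma]=A(1,\gamma)$, $b[\gamma]=b_0+\sum_{i=1}^m\gamma_ib_i$ and $[\gamma,q(x)]=\langle(1,\gamma),q(x)\rangle$. Define $$\mathcal S=\{(x,t)\in\mathbb{R}^{n}\times\mathbb{R}: q_0(x)\le 2t,\ q_i(x)\le 0\ (i=1,\dots,m)\},$$ $$\mathcal S_{\mathrm{SDP}}=\{(x,t): \exists X\succeq xx^\top,\ \langle A_0,X\rangle+2b_0^\top x+c_0\le 2t,\ \langle A_i,X\rangle+2b_i^\top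 x+c_i\le 0\ (i=1,\dots,m)\},$$ $$\Gamma=\{(\gamma_{\mathrm{obj}},\gamma)\in\mathbb{R}^{1+m}_+: A(\gamma_{\mathrm{obj}},\gamma)\succeq 0\},\qquad \Gamma_1=\{\gamma\in\mathbb{R}^m_+: A[\gamma]\succeq 0\},$$ and let $\Gamma^\circ$ be the polar cone of $\Gamma$. For $(x,t)\in\mathcal S_{\mathrm{SDP}}$ let $\mathcal G(x,t)$ be the minimal face of $\Gamma^\circ$ containing $q(x)-2te_{\mathrm{obj}}$, let $\mathcal F(x,t)=\Gamma\cap\mathcal G(x,t)^\perp$, and let $$\mathcal R'(x,t)=\{(x',t')\in\mathbb{R}^n\times\mathbb{R}: q(x+\alpha x')-2(t+\alpha t')e_{\mathrm{obj}}\in\operatorname{span}\mathcal G(x,t)\ \text{for all }\alpha\in\mathbb{R}\}.$$ For a face $\mathcal F$ of $\Gamma$ and $f\in\mathbb{R}^m$ let $$D(\mathcal F,f)=\{(x',t')\in\mathbb{R}^n\times\mathbb{R}: x'\in\ker A[f],\ \langle b[\gamma],x'\rangle-t'=0\ \text{for all }\gamma\text{ with }(1,\gamma)\in\mathcal F\}.$$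 **Theorem.** Assume that there is $(\gamma^*_{\mathrm{obj}},\gamma^*)\in\Gamma$ with $A(\gamma^*_{\mathrm{obj}},\gamma^*)\succ0$, and that $\Gamma$ is polyhedral. 1. For every $(x,t)\in\mathcal S_{\mathrm{SDP}}$ with $2t=\sup_{\gamma\in\Gamma_1}[\gamma,q(x)]$, there is an $f\in\mathbb{R}^m$ such that $(1,f)$ lies in the relative interior of $\mathcal F(x,t)$, and for every such $f$ $$\mathcal R'(x,t)=D(\mathcal F(x,t),f).$$ 2. $\operatorname{conv}(\mathcal S)=\mathcal S_{\mathrm{SDP}}$ if and only if $D(\mathcal F,f)\neq\{0\}$ for every face $\mathcal F$ of $\Gamma$ that is exposed by $q(x)-2te_{\mathrm{obj}}$ for some $(x,t)\in\mathcal S_{\mathrm{SDP}}\setminus\mathcal S$ (that is, $q(x)-2te_{\mathrm{obj}}\in\Gamma^\circ$ and $\mathcal F=\Gamma\cap(q(x)-2te_{\mathrm{obj}})^\perp$) and every $f\in\mathbb{R}^m$ such that $(1,f)$ lies in the relative interior of $\mathcal F$. -/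

import Mathlib

open Matrix

/-! ## Cones in `ℝ^k`

`ℝ^k` is `Fin k → ℝ` with the pairing `⬝ᵥ`. Only linear, order and topological notions are used, so
the choice of a norm on this finite-dimensional space does not matter. -/

/-- The standard inner product of `ℝ^k`, as a bilinear map. -/
noncomputable abbrev stdPairing (k : ℕ) : (Fin k → ℝ) →ₗ[ℝ] (Fin k → ℝ) →ₗ[ℝ] ℝ :=
  dotProductBilin ℝ ℝ

/-- The orthogonal complement `M^⊥` of a subset of `ℝ^k`. -/
def orthCompl {k : ℕ} (M : Set (Fin k → ℝ)) : Submodule ℝ (Fin k → ℝ) where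
  carrier := {y | ∀ x ∈ M, x ⬝ᵥ y = 0}
  zero_mem' := fun x _ => dotProduct_zero x
  add_mem' := fun {a b} ha hb x hx => by rw [dotProduct_add, ha x hx, hb x hx, add_zero]
  smul_mem' := fun c y hy x hx => by rw [dotProduct_smul, hy x hx, smul_zero]

/-- The polar cone `K° = {y | ⟨x, y⟩ ≤ 0 for all x ∈ K}`. -/
noncomputable def polarCone {k : ℕ} (K : PointedCone ℝ (Fin k → ℝ)) :
    PointedCone ℝ (Fin k → ℝ) :=
  PointedCone.dual (-(stdPairing k)) (K : Set (Fin k → ℝ))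

theorem mem_polarCone {k : ℕ} {K : PointedCone ℝ (Fin k → ℝ)} {y : Fin k → ℝ} :
    y ∈ polarCone K ↔ ∀ x ∈ K, x ⬝ᵥ y ≤ 0 := by
  simp [polarCone, dotProductBilin]

/-- A cone is polyhedral if it is the intersection of finitely many closed halfspaces through the
origin, i.e. the dual of a finite set. -/
def IsPolyhedralCone {k : ℕ} (K : PointedCone ℝ (Fin k → ℝ)) : Prop :=
  K.DualFG (stdPairing k)

theorem isPolyhedralCone_iff {k : ℕ} {K : PointedCone ℝ (Fin k → ℝ)} :
    IsPolyhedralCone K ↔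
      ∃ s : Finset (Fin k → ℝ), (K : Set (Fin k → ℝ)) = {y | ∀ a ∈ s, 0 ≤ a ⬝ᵥ y} := by
  constructor
  · rintro ⟨s, rfl⟩
    exact ⟨s, rfl⟩
  · rintro ⟨s, hs⟩
    exact ⟨s, SetLike.coe_injective hs.symm⟩

/-- The minimal face of the cone `K` containing `v`: the intersection of all faces of `K` that
contain `v`. -/
noncomputable def minimalFace {k : ℕ} (K : PointedCone ℝ (Fin k → ℝ)) (v : Fin k → ℝ) :
    PointedCone ℝ (Fin k → ℝ) :=
  sInf {G | G.IsFaceOf K ∧ v ∈ G}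

/-- `K ∩ G^⊥`. For `K = Γ` and a face `G` of `Γ°` this is the conjugate face of `G`. -/
def conjugateFace {k : ℕ} (K G : PointedCone ℝ (Fin k → ℝ)) : PointedCone ℝ (Fin k → ℝ) :=
  K ⊓ PointedCone.ofSubmodule (orthCompl (G : Set (Fin k → ℝ)))

/-- `F` is the face of `K` exposed by `v ∈ K°`: it is a face of `K`, and `F = K ∩ v^⊥`. -/
def IsFaceExposedBy {k : ℕ} (F K : PointedCone ℝ (Fin k → ℝ)) (v : Fin k → ℝ) : Prop :=
  F.IsFaceOf K ∧ v ∈ polarCone K ∧ (F : Set (Fin k → ℝ)) = {y | y ∈ K ∧ v ⬝ᵥ y = 0}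

/-! ## Quadratically constrained quadratic programs -/

/-- The data of a QCQP `inf {q₀(x) | qᵢ(x) ≤ 0, i = 1, …, m}` over `ℝ^n`, where
`qᵢ(x) = xᵀ Aᵢ x + 2 bᵢᵀ x + cᵢ` with `Aᵢ` symmetric. Index `0` is the objective ("obj"), and the
`m` constraints have the indices `Fin.succ i`. -/
structure QCQP (n m : ℕ) where
  A : Fin (m + 1) → Matrix (Fin n) (Fin n) ℝ
  b : Fin (m + 1) → Fin n → ℝ
  c : Fin (m + 1) → ℝ
  A_symm : ∀ i, (A i).IsSymm

namespace QCQP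

variable {n m : ℕ}

/-- The quadratic map `q : ℝ^n → ℝ^{1+m}`. -/
def q (Q : QCQP n m) (x : Fin n → ℝ) : Fin (m + 1) → ℝ :=
  fun i => x ⬝ᵥ (Q.A i *ᵥ x) + 2 * (Q.b i ⬝ᵥ x) + Q.c i

/-- The aggregated matrix `A(γ_obj, γ) = ∑ᵢ γᵢ Aᵢ`. -/
def aggA (Q : QCQP n m) (γ : Fin (m + 1) → ℝ) : Matrix (Fin n) (Fin n) ℝ :=
  ∑ i, γ i • Q.A i

/-- The aggregated vector `b(γ_obj, γ) = ∑ᵢ γᵢ bᵢ`. -/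
def aggb (Q : QCQP n m) (γ : Fin (m + 1) → ℝ) : Fin n → ℝ :=
  ∑ i, γ i • Q.b i

/-- The vector `(1, γ) ∈ ℝ^{1+m}`. -/
def one_cons (γ : Fin m → ℝ) : Fin (m + 1) → ℝ := Fin.cons 1 γ

/-- The unit vector `e_obj ∈ ℝ^{1+m}`. -/
def eObj : Fin (m + 1) → ℝ := Pi.single 0 1

/-- The epigraph `S` of the QCQP. -/
def S (Q : QCQP n m) : Set ((Fin n → ℝ) × ℝ) :=
  {p | Q.q p.1 0 ≤ 2 * p.2 ∧ ∀ i : Fin m, Q.q p.1 i.succ ≤ 0}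

/-- The projected SDP relaxation `S_SDP`: there is `X ⪰ x xᵀ` with
`⟨A_obj, X⟩ + 2 b_objᵀ x + c_obj ≤ 2 t` and `⟨Aᵢ, X⟩ + 2 bᵢᵀ x + cᵢ ≤ 0` for all `i`. -/
def SDP (Q : QCQP n m) : Set ((Fin n → ℝ) × ℝ) :=
  {p | ∃ X : Matrix (Fin n) (Fin n) ℝ, (X - vecMulVec p.1 p.1).PosSemidef ∧
    ((Q.A 0)ᵀ * X).trace + 2 * (Q.b 0 ⬝ᵥ p.1) + Q.c 0 ≤ 2 * p.2 ∧
    ∀ i : Fin m, ((Q.A i.succ)ᵀ * X).trace + 2 * (Q.b i.succ ⬝ᵥ p.1) + Q.c i.succ ≤ 0}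

/-- The cone `Γ` of convex Lagrange multipliers. -/
def Gam (Q : QCQP n m) : PointedCone ℝ (Fin (m + 1) → ℝ) where
  carrier := {γ | (∀ i, 0 ≤ γ i) ∧ (Q.aggA γ).PosSemidef}
  zero_mem' := by
    refine ⟨fun i => le_rfl, ?_⟩
    have h : Q.aggA 0 = 0 := by simp [aggA]
    rw [h]
    exact PosSemidef.zero
  add_mem' := by
    intro γ δ hγ hδ
    refine ⟨fun i => add_nonneg (hγ.1 i) (hδ.1 i), ?_⟩
    have h : Q.aggA (γ + δ) = Q.aggA γ + Q.aggA δ := by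
      simp [aggA, add_smul, Finset.sum_add_distrib]
    rw [h]
    exact hγ.2.add hδ.2
  smul_mem' := by
    intro r γ hγ
    refine ⟨fun i => mul_nonneg r.2 (hγ.1 i), ?_⟩
    have h : Q.aggA (r • γ) = (r : ℝ) • Q.aggA γ := by
      simp only [aggA, Finset.smul_sum, smul_smul]
      rfl
    rw [h]
    exact hγ.2.smul r.2

/-- The slice `Γ₁ = {γ ∈ ℝ^m₊ | A[γ] ⪰ 0}`, where `A[γ] = A(1, γ)`. -/
def Gam₁ (Q : QCQP n m) : Set (Fin m → ℝ) :=
  {γ | (∀ i, 0 ≤ γ i) ∧ (Q.aggA (one_cons γ)).PosSemidef}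

/-- The dual strict feasibility assumption: `A(γ) ≻ 0` for some `γ ∈ Γ`. -/
def DualStrictlyFeasible (Q : QCQP n m) : Prop :=
  ∃ γ ∈ Q.Gam, (Q.aggA γ).PosDef

/-- The vector `q(x) - 2 t e_obj`. -/
def slack (Q : QCQP n m) (x : Fin n → ℝ) (t : ℝ) : Fin (m + 1) → ℝ :=
  Q.q x - (2 * t) • eObj

/-- `G(x,t)`, the minimal face of `Γ°` containing `q(x) - 2 t e_obj`. -/
noncomputable def faceG (Q : QCQP n m) (x : Fin n → ℝ) (t : ℝ) :
    PointedCone ℝ (Fin (m + 1) → ℝ) :=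
  minimalFace (polarCone Q.Gam) (Q.slack x t)

/-- `F(x,t) = Γ ∩ G(x,t)^⊥`, the conjugate face of `G(x,t)`. -/
noncomputable def faceF (Q : QCQP n m) (x : Fin n → ℝ) (t : ℝ) :
    PointedCone ℝ (Fin (m + 1) → ℝ) :=
  conjugateFace Q.Gam (Q.faceG x t)

/-- `(x,t)` is epigraph-tight: `2 t = sup_{γ ∈ Γ₁} [γ, q(x)]`, where
`[γ, q(x)] = ⟨(1, γ), q(x)⟩`. The supremum is a genuine least upper bound in `ℝ`. -/
def EpigraphTight (Q : QCQP n m) (x : Fin n → ℝ) (t : ℝ) : Prop :=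
  IsLUB ((fun γ : Fin m → ℝ => one_cons γ ⬝ᵥ Q.q x) '' Q.Gam₁) (2 * t)

/-- `R'(x,t)`, the set of all `(x',t')` with
`q(x + α x') - 2 (t + α t') e_obj ∈ span G(x,t)` for all `α ∈ ℝ`. -/
def R' (Q : QCQP n m) (x : Fin n → ℝ) (t : ℝ) : Set ((Fin n → ℝ) × ℝ) :=
  {p | ∀ α : ℝ, Q.slack (x + α • p.1) (t + α * p.2) ∈
    Submodule.span ℝ (Q.faceG x t : Set (Fin (m + 1) → ℝ))}

/-- The set of all `(x',t')` with `x' ∈ ker A[f]` and `⟨b[γ], x'⟩ - t' = 0` for all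
`(1, γ) ∈ F`. -/
def faceDirections (Q : QCQP n m) (F : PointedCone ℝ (Fin (m + 1) → ℝ)) (f : Fin m → ℝ) :
    Set ((Fin n → ℝ) × ℝ) :=
  {p | Q.aggA (one_cons f) *ᵥ p.1 = 0 ∧
    ∀ γ : Fin m → ℝ, one_cons γ ∈ F → Q.aggb (one_cons γ) ⬝ᵥ p.1 - p.2 = 0}

end QCQP

/-! ## Polyhedral cones are finitely generated -/

/-! Three facts carry the theorem. Duality (`QCQP.mem_SDP_iff`): dual strict feasibility makes the
cone of attainable right-hand sides closed, so separation shows that `(x, t)` is in the relaxation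
exactly when its slack `q(x) - 2 t e_obj` lies in `Γ°`. Convexity: along a line in direction `d =
(x', t')`, the pairing of the slack with `γ ∈ Γ` is a quadratic polynomial with leading coefficient
`x'ᵀ A(γ) x' ≥ 0`. Polyhedrality (`eventually_mem_polarCone`): `Γ` has finitely many generators, so
a curve from a point of `Γ°` that stays orthogonal to the face `F` exposed there remains in `Γ°` for
a short time.

Part 1. Polyhedrality gives `span G = F^⊥`, so `R'` consists of the directions whose linear and
quadratic slack coefficients are both orthogonal to `F`. Semidefiniteness and a relative interior
point `(1, f)` turn this into `D(F, f)`.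

Part 2, sufficiency. Lower `t` until `F` contains some `(1, γ)`. A nonzero `d` in `D(F, f)` then has
`x' ≠ 0`, and positive definiteness of some `A(γ)` forces the line to leave the relaxation both
ways. At each exit the exposed face is strictly larger, so induction on its span puts both exits in
the hull, and the point lies between them.

Part 2, necessity. A point outside `S` is not extreme in `conv S`, so it is interior to a segment of
the relaxation. Along it, each `γ ∈ F` yields a convex quadratic that is nonpositive on both sides
of a zero, hence identically zero; the segment's direction lies in `D(F, f)`. -/

theorem dotProduct_nonneg_of_mem_hull {k : ℕ} {a : Fin k → ℝ} {s : Set (Fin k → ℝ)}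
    (h : ∀ g ∈ s, 0 ≤ a ⬝ᵥ g) {y : Fin k → ℝ} (hy : y ∈ PointedCone.hull ℝ s) : 0 ≤ a ⬝ᵥ y := by
  induction hy using Submodule.span_induction with
  | mem x hx => exact h x hx
  | zero => simp
  | add x y _ _ hx hy => rw [dotProduct_add]; exact add_nonneg hx hy
  | smul c x _ hx =>
    change 0 ≤ a ⬝ᵥ ((c : ℝ) • x)
    rw [dotProduct_smul]; exact mul_nonneg c.2 hx

theorem dotProduct_nonpos_of_mem_hull {k : ℕ} {a : Fin k → ℝ} {s : Set (Fin k → ℝ)}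
    (h : ∀ g ∈ s, a ⬝ᵥ g ≤ 0) {y : Fin k → ℝ} (hy : y ∈ PointedCone.hull ℝ s) : a ⬝ᵥ y ≤ 0 := by
  have := dotProduct_nonneg_of_mem_hull (a := -a) (s := s)
    (fun g hg => by rw [neg_dotProduct]; linarith [h g hg]) hy
  rw [neg_dotProduct] at this
  linarith

/-- One step of the double description method: the intersection of a finitely generated cone with
a closed halfspace is finitely generated. -/
theorem exists_hull_inter_halfspace {k : ℕ} (G : Finset (Fin k → ℝ)) (a : Fin k → ℝ) :
    ∃ H : Finset (Fin k → ℝ), ∀ y, y ∈ PointedCone.hull ℝ (H : Set (Fin k → ℝ)) ↔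
      y ∈ PointedCone.hull ℝ (G : Set (Fin k → ℝ)) ∧ 0 ≤ a ⬝ᵥ y := by
  classical
  set P := G.filter (fun g => 0 ≤ a ⬝ᵥ g) with hP
  set N := G.filter (fun g => a ⬝ᵥ g < 0) with hN
  set M := Finset.image₂ (fun g h => (-(a ⬝ᵥ h)) • g + (a ⬝ᵥ g) • h) P N with hM
  set T := PointedCone.hull ℝ ((P ∪ M : Finset (Fin k → ℝ)) : Set (Fin k → ℝ)) with hT
  have hM0 : ∀ y ∈ M, a ⬝ᵥ y = 0 := by
    intro y hy
    obtain ⟨g, -, h, -, rfl⟩ := Finset.mem_image₂.1 hy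
    simp only [dotProduct_add, dotProduct_smul, smul_eq_mul]; ring
  refine ⟨P ∪ M, fun y => ⟨fun hy => ⟨?_, ?_⟩, ?_⟩⟩
  · refine (Submodule.span_le.2 ?_ : T ≤ _) hy
    intro z hz
    rcases Finset.mem_union.1 (Finset.mem_coe.1 hz) with hz | hz
    · exact PointedCone.subset_hull (Finset.mem_filter.1 hz).1
    · obtain ⟨g, hg, h, hh, rfl⟩ := Finset.mem_image₂.1 hz
      obtain ⟨hg, hg'⟩ := Finset.mem_filter.1 hg
      obtain ⟨hh, hh'⟩ := Finset.mem_filter.1 hh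
      exact add_mem (PointedCone.smul_mem _ (by linarith) (PointedCone.subset_hull hg))
        (PointedCone.smul_mem _ hg' (PointedCone.subset_hull hh))
  · refine dotProduct_nonneg_of_mem_hull ?_ hy
    intro z hz
    rcases Finset.mem_union.1 (Finset.mem_coe.1 hz) with hz | hz
    · exact (Finset.mem_filter.1 hz).2
    · exact (hM0 z hz).ge
  · rintro ⟨hy, hay⟩
    -- The expression is linear in `u`, so generators suffice: `P` yields elements of `M` by
    -- construction, and on `M` only a nonnegative multiple of `u` survives.
    have hproj : ∀ h ∈ N, ∀ u ∈ T, (-(a ⬝ᵥ h)) • u + (a ⬝ᵥ u) • h ∈ T := by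
      intro h hh u hu
      induction hu using Submodule.span_induction with
      | mem x hx =>
        rcases Finset.mem_union.1 (Finset.mem_coe.1 hx) with hx' | hx'
        · exact PointedCone.subset_hull (Finset.mem_coe.2 (Finset.mem_union_right _
            (Finset.mem_image₂_of_mem hx' hh)))
        · rw [hM0 x hx', zero_smul, add_zero]
          exact PointedCone.smul_mem _ (by linarith [(Finset.mem_filter.1 hh).2])
            (PointedCone.subset_hull hx)
      | zero => simp
      | add x y _ _ hx hy =>
        convert add_mem hx hy using 1
        rw [dotProduct_add]; module
      | smul c x _ hx =>
        convert PointedCone.smul_mem T c.2 hx using 1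
        change (-(a ⬝ᵥ h)) • ((c : ℝ) • x) + (a ⬝ᵥ ((c : ℝ) • x)) • h = _
        rw [dotProduct_smul, smul_eq_mul]; module
    -- Summands from `N` are added one at a time. The later ones only lower `a ⬝ᵥ ·`, so every
    -- partial sum is still in the halfspace.
    have hneg : ∀ z ∈ PointedCone.hull ℝ (N : Set (Fin k → ℝ)), ∀ u ∈ T,
        0 ≤ a ⬝ᵥ (u + z) → u + z ∈ T := by
      intro z hz
      induction hz using Submodule.span_induction with
      | mem h hh =>
        intro u hu hau
        have hh' := (Finset.mem_filter.1 (Finset.mem_coe.1 hh)).2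
        rw [dotProduct_add] at hau
        have hpos : 0 < a ⬝ᵥ u := by linarith
        -- The two summands, with coefficients `a ⬝ᵥ (u + h)` on `u` and the projection of `h`, add
        -- up to `(a ⬝ᵥ u) • (u + h)`.
        have h1 := add_mem (PointedCone.smul_mem T hau hu) (hproj h hh u hu)
        convert PointedCone.smul_mem T (inv_nonneg.2 hpos.le) h1 using 1
        have : u + h = ((a ⬝ᵥ u)⁻¹ * (a ⬝ᵥ u)) • (u + h) := by
          rw [inv_mul_cancel₀ hpos.ne', one_smul]
        rw [this]; module
      | zero => intro u hu _; simpa using hu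
      | add x y hx' hy' hx hy =>
        intro u hu hau
        have hy0 : a ⬝ᵥ y ≤ 0 :=
          dotProduct_nonpos_of_mem_hull (fun g hg => (Finset.mem_filter.1 hg).2.le) hy'
        rw [← add_assoc] at hau ⊢
        refine hy _ (hx u hu ?_) hau
        rw [dotProduct_add] at hau; linarith
      | smul c x hx' hx =>
        intro u hu hau
        change 0 ≤ a ⬝ᵥ (u + (c : ℝ) • x) at hau
        change u + (c : ℝ) • x ∈ T
        rcases c.2.eq_or_lt with hc | hc
        · rw [← hc]; simpa using hu
        · have h1 : u + (c : ℝ) • x = (c : ℝ) • ((c : ℝ)⁻¹ • u + x) := by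
            rw [smul_add, smul_smul, mul_inv_cancel₀ hc.ne', one_smul]
          rw [h1] at hau ⊢
          refine PointedCone.smul_mem T hc.le
            (hx _ (PointedCone.smul_mem T (inv_nonneg.2 hc.le) hu) ?_)
          rw [dotProduct_smul, smul_eq_mul] at hau
          exact nonneg_of_mul_nonneg_right hau hc
    have hGu : (G : Set (Fin k → ℝ)) ⊆ P ∪ N := by
      intro g hg
      rcases lt_or_ge (a ⬝ᵥ g) 0 with h | h
      · exact Or.inr (Finset.mem_coe.2 (Finset.mem_filter.2 ⟨hg, h⟩))
      · exact Or.inl (Finset.mem_coe.2 (Finset.mem_filter.2 ⟨hg, h⟩))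
    have hy' := Submodule.span_mono (R := {c : ℝ // 0 ≤ c}) hGu hy
    rw [Submodule.span_union] at hy'
    obtain ⟨u, hu, z, hz, rfl⟩ := Submodule.mem_sup.1 hy'
    refine hneg z hz u (Submodule.span_mono ?_ hu) hay
    simp

/-- The Minkowski–Weyl theorem: a polyhedral cone is finitely generated. -/
theorem IsPolyhedralCone.exists_hull {k : ℕ} {K : PointedCone ℝ (Fin k → ℝ)}
    (hK : IsPolyhedralCone K) :
    ∃ G : Finset (Fin k → ℝ), K = PointedCone.hull ℝ (G : Set (Fin k → ℝ)) := by
  classical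
  obtain ⟨s, hs⟩ := isPolyhedralCone_iff.1 hK
  have key : ∃ G : Finset (Fin k → ℝ), ∀ y, y ∈ PointedCone.hull ℝ (G : Set (Fin k → ℝ)) ↔
      ∀ a ∈ s, 0 ≤ a ⬝ᵥ y := by
    clear hs
    induction s using Finset.induction_on with
    | empty =>
      refine ⟨Finset.univ.image (fun i => Pi.single i (1 : ℝ)) ∪
        Finset.univ.image (fun i => Pi.single i (-1 : ℝ)), fun y => ⟨by simp, fun _ => ?_⟩⟩
      rw [← Finset.univ_sum_single y]
      refine sum_mem fun i _ => ?_
      rcases le_total 0 (y i) with h | h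
      · have : Pi.single i (y i) = y i • (Pi.single i (1 : ℝ) : Fin k → ℝ) := by
          rw [← Pi.single_smul]; simp
        rw [this]
        exact PointedCone.smul_mem _ h (PointedCone.subset_hull (by simp))
      · have : Pi.single i (y i) = (-y i) • (Pi.single i (-1 : ℝ) : Fin k → ℝ) := by
          rw [← Pi.single_smul]; simp
        rw [this]
        exact PointedCone.smul_mem _ (by linarith) (PointedCone.subset_hull (by simp))
    | insert a s _ ih =>
      obtain ⟨G, hG⟩ := ih
      obtain ⟨H, hH⟩ := exists_hull_inter_halfspace G a
      refine ⟨H, fun y => ?_⟩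
      rw [hH, hG, Finset.forall_mem_insert, and_comm]
  obtain ⟨G, hG⟩ := key
  refine ⟨G, SetLike.coe_injective ?_⟩
  rw [hs]
  ext y
  exact (hG y).symm

/-! ## Relative interiors of cones -/

/-- The line through `z` and `y` lies in the affine span of `F`, where `z` is an interior point, so
it can be prolonged slightly beyond `z`. -/
theorem exists_sub_smul_mem_of_mem_intrinsicInterior {k : ℕ} {F : Set (Fin k → ℝ)}
    {z y : Fin k → ℝ} (hz : z ∈ intrinsicInterior ℝ F) (hy : y ∈ F) :
    ∃ ε : ℝ, 0 < ε ∧ z - ε • (y - z) ∈ F := by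
  obtain ⟨w, hw, rfl⟩ := hz
  have hyA : y ∈ affineSpan ℝ F := subset_affineSpan ℝ F hy
  let c : ℝ → affineSpan ℝ F := fun s =>
    ⟨AffineMap.lineMap (w : Fin k → ℝ) y s, AffineMap.lineMap_mem s w.2 hyA⟩
  have hc : Continuous c := Continuous.subtype_mk (by fun_prop) _
  have hc0 : c 0 = w := Subtype.ext (by simp [c])
  have h1 : ∀ᶠ s in nhds (0 : ℝ), c s ∈ ((↑) ⁻¹' F : Set (affineSpan ℝ F)) :=
    hc.continuousAt.eventually_mem (by rw [hc0]; exact mem_interior_iff_mem_nhds.1 hw)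
  obtain ⟨r, hr, hball⟩ := Metric.eventually_nhds_iff.1 h1
  refine ⟨r / 2, by linarith, ?_⟩
  have h2 := hball (y := -(r / 2)) (by rw [Real.dist_eq, sub_zero, abs_neg, abs_of_pos] <;> linarith)
  have h3 : (c (-(r / 2)) : Fin k → ℝ) = w - (r / 2) • (y - w) := by
    simp only [c, AffineMap.lineMap_apply, vsub_eq_sub, vadd_eq_add]; module
  rw [← h3]
  exact h2

theorem smul_mem_intrinsicInterior {k : ℕ} (F : PointedCone ℝ (Fin k → ℝ)) {c : ℝ} (hc : 0 < c)
    {z : Fin k → ℝ} (hz : z ∈ intrinsicInterior ℝ (F : Set (Fin k → ℝ))) :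
    c • z ∈ intrinsicInterior ℝ (F : Set (Fin k → ℝ)) := by
  let e : (Fin k → ℝ) ≃ᵃ[ℝ] (Fin k → ℝ) :=
    (LinearEquiv.smulOfNeZero ℝ (Fin k → ℝ) c hc.ne').toAffineEquiv
  have he : ∀ y, e y = c • y := fun y => rfl
  have himg : e '' (F : Set (Fin k → ℝ)) = F := by
    ext y
    constructor
    · rintro ⟨x, hx, rfl⟩
      exact PointedCone.smul_mem F hc.le hx
    · intro hy
      refine ⟨c⁻¹ • y, PointedCone.smul_mem F (inv_nonneg.2 hc.le) hy, ?_⟩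
      rw [he, smul_smul, mul_inv_cancel₀ hc.ne', one_smul]
  rw [← himg, AffineEquiv.intrinsicInterior_image]
  exact ⟨z, hz, he z⟩

theorem exists_one_cons_eq {m : ℕ} {y : Fin (m + 1) → ℝ} (hy : y 0 = 1) :
    ∃ γ : Fin m → ℝ, QCQP.one_cons γ = y :=
  ⟨Fin.tail y, by rw [QCQP.one_cons, ← hy]; exact Fin.cons_self_tail y⟩

/-- A cone in the halfspace `y₀ ≥ 0` that contains some `(1, γ)` contains such a vector in its
relative interior. -/
theorem exists_one_cons_mem_intrinsicInterior {m : ℕ} (F : PointedCone ℝ (Fin (m + 1) → ℝ))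
    (hF : ∀ y ∈ F, 0 ≤ y 0) {γ : Fin m → ℝ} (hγ : QCQP.one_cons γ ∈ F) :
    ∃ f : Fin m → ℝ, QCQP.one_cons f ∈ intrinsicInterior ℝ (F : Set (Fin (m + 1) → ℝ)) := by
  obtain ⟨z, hz⟩ := Set.Nonempty.intrinsicInterior F.convex ⟨_, hγ⟩
  obtain ⟨ε, hε, h⟩ := exists_sub_smul_mem_of_mem_intrinsicInterior hz hγ
  have h0 := hF _ h
  have hz0 : 0 < z 0 := by
    simp only [QCQP.one_cons, Pi.sub_apply, Pi.smul_apply, Fin.cons_zero, smul_eq_mul] at h0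
    -- The prolonged point has zeroth coordinate `z 0 - ε * (1 - z 0)`, which is negative if `z 0 ≤
    -- 0`.
    by_contra hcon
    nlinarith
  obtain ⟨f, hf⟩ := exists_one_cons_eq (y := (z 0)⁻¹ • z) (by simp [hz0.ne'])
  exact ⟨f, hf ▸ smul_mem_intrinsicInterior F (inv_pos.2 hz0) hz⟩

/-! ## Faces -/

/-- The face of `K` exposed by `v ∈ K°`. -/
def exposedFace {k : ℕ} (K : PointedCone ℝ (Fin k → ℝ)) (v : Fin k → ℝ) :
    PointedCone ℝ (Fin k → ℝ) :=
  K ⊓ PointedCone.ofSubmodule (orthCompl {v})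

theorem mem_exposedFace {k : ℕ} {K : PointedCone ℝ (Fin k → ℝ)} {v y : Fin k → ℝ} :
    y ∈ exposedFace K v ↔ y ∈ K ∧ v ⬝ᵥ y = 0 := by
  simp only [exposedFace, Submodule.mem_inf, PointedCone.mem_ofSubmodule_iff]
  refine and_congr_right fun _ => ⟨fun h => h v rfl, ?_⟩
  rintro h _ rfl
  exact h

theorem isFaceOf_of_forall_dotProduct_nonpos {k : ℕ} {F K : PointedCone ℝ (Fin k → ℝ)}
    {v : Fin k → ℝ} (hv : ∀ x ∈ K, v ⬝ᵥ x ≤ 0) (hF : ∀ y, y ∈ F ↔ y ∈ K ∧ v ⬝ᵥ y = 0) :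
    F.IsFaceOf K := by
  refine ⟨fun y hy => ((hF y).1 hy).1, fun {x y a} hx hy ha h => (hF x).2 ⟨hx, ?_⟩⟩
  have h0 := ((hF _).1 h).2
  rw [dotProduct_add, dotProduct_smul, smul_eq_mul] at h0
  have := hv x hx
  have := hv y hy
  nlinarith

theorem isFaceExposedBy_exposedFace {k : ℕ} {K : PointedCone ℝ (Fin k → ℝ)} {v : Fin k → ℝ}
    (hv : v ∈ polarCone K) : IsFaceExposedBy (exposedFace K v) K v := by
  refine ⟨isFaceOf_of_forall_dotProduct_nonpos (v := v) (fun x hx => ?_)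
    fun y => mem_exposedFace, hv, Set.ext fun y => mem_exposedFace⟩
  rw [dotProduct_comm]
  exact mem_polarCone.1 hv x hx

theorem mem_minimalFace {k : ℕ} {K : PointedCone ℝ (Fin k → ℝ)} {v y : Fin k → ℝ} :
    y ∈ minimalFace K v ↔ ∀ G : PointedCone ℝ (Fin k → ℝ), G.IsFaceOf K → v ∈ G → y ∈ G := by
  simp [minimalFace, Submodule.mem_sInf]

theorem self_mem_minimalFace {k : ℕ} {K : PointedCone ℝ (Fin k → ℝ)} {v : Fin k → ℝ} :
    v ∈ minimalFace K v :=
  mem_minimalFace.2 fun _ _ h => h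

/-- Each `y ∈ K` orthogonal to `v` exposes a face of `K°` containing `v`; the minimal face lies
inside it and so is orthogonal to `y`. -/
theorem conjugateFace_minimalFace {k : ℕ} {K : PointedCone ℝ (Fin k → ℝ)} {v : Fin k → ℝ}
    (hv : v ∈ polarCone K) :
    conjugateFace K (minimalFace (polarCone K) v) = exposedFace K v := by
  ext y
  rw [mem_exposedFace]
  simp only [conjugateFace, Submodule.mem_inf, PointedCone.mem_ofSubmodule_iff]
  refine and_congr_right fun hy => ⟨fun h => h v self_mem_minimalFace, fun h x hx => ?_⟩
  have hface : (exposedFace (polarCone K) y).IsFaceOf (polarCone K) :=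
    isFaceOf_of_forall_dotProduct_nonpos (v := y) (fun x hx => mem_polarCone.1 hx y hy)
      fun x => mem_exposedFace
  have := mem_minimalFace.1 hx _ hface (mem_exposedFace.2 ⟨hv, by rwa [dotProduct_comm]⟩)
  rw [dotProduct_comm]
  exact (mem_exposedFace.1 this).2

/-- A curve through `v ∈ K°` that stays orthogonal to the face of the polyhedral cone `K` exposed by
`v` stays in `K°` for a short time. -/
theorem eventually_mem_polarCone {k : ℕ} {K : PointedCone ℝ (Fin k → ℝ)}
    (hK : IsPolyhedralCone K) {c : ℝ → Fin k → ℝ} (hc : Continuous c) (h0 : c 0 ∈ polarCone K)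
    (horth : ∀ y ∈ exposedFace K (c 0), ∀ ε, y ⬝ᵥ c ε = 0) :
    ∀ᶠ ε in nhds (0 : ℝ), c ε ∈ polarCone K := by
  obtain ⟨G, rfl⟩ := hK.exists_hull
  have h1 : ∀ g ∈ G, ∀ᶠ ε in nhds (0 : ℝ), c ε ⬝ᵥ g ≤ 0 := by
    intro g hg
    have hgK := PointedCone.subset_hull (R := ℝ) (Finset.mem_coe.2 hg)
    have hle := mem_polarCone.1 h0 g hgK
    rw [dotProduct_comm] at hle
    -- A generator in the exposed face pairs to zero with the whole curve; for any other the
    -- inequality is strict at `0` and persists by continuity.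
    rcases hle.eq_or_lt with h | h
    · exact Filter.Eventually.of_forall fun ε => by
        rw [dotProduct_comm, horth g (mem_exposedFace.2 ⟨hgK, h⟩)]
    · have hcont : Continuous fun ε : ℝ => c ε ⬝ᵥ g := by fun_prop
      exact ((hcont.tendsto 0).eventually_lt_const h).mono fun ε h => h.le
  filter_upwards [(Filter.eventually_all_finset G).2 h1] with ε hε
  refine mem_polarCone.2 fun x hx => ?_
  rw [dotProduct_comm]
  exact dotProduct_nonpos_of_mem_hull hε hx

theorem exists_pos_of_eventually_nhds_zero {p : ℝ → Prop} (h : ∀ᶠ ε in nhds (0 : ℝ), p ε) :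
    ∃ ε : ℝ, 0 < ε ∧ p ε := by
  obtain ⟨ε, hε, hpos⟩ := ((h.filter_mono nhdsWithin_le_nhds).and
    (self_mem_nhdsWithin : Set.Ioi (0 : ℝ) ∈ nhdsWithin 0 (Set.Ioi 0))).exists
  exact ⟨ε, hpos, hε⟩

/-- For a polyhedral cone `K`, the minimal face of `K°` containing `v` spans the orthogonal
complement of the face of `K` exposed by `v`. -/
theorem mem_span_minimalFace_iff {k : ℕ} {K : PointedCone ℝ (Fin k → ℝ)}
    (hK : IsPolyhedralCone K) {v : Fin k → ℝ} (hv : v ∈ polarCone K) {w : Fin k → ℝ} :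
    w ∈ Submodule.span ℝ (minimalFace (polarCone K) v : Set (Fin k → ℝ)) ↔
      ∀ y ∈ exposedFace K v, y ⬝ᵥ w = 0 := by
  constructor
  · intro hw y hy
    rw [← conjugateFace_minimalFace hv] at hy
    have hle : Submodule.span ℝ (minimalFace (polarCone K) v : Set (Fin k → ℝ)) ≤ orthCompl {y} :=
      Submodule.span_le.2 fun x hx => by
        rintro _ rfl
        rw [dotProduct_comm]
        exact hy.2 x hx
    exact hle hw y rfl
  · intro hw
    have hev : ∀ u : Fin k → ℝ, (∀ y ∈ exposedFace K v, y ⬝ᵥ u = 0) →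
        ∀ᶠ ε in nhds (0 : ℝ), v + ε • u ∈ polarCone K := by
      intro u hu
      refine eventually_mem_polarCone hK (by fun_prop) (by simpa using hv) fun y hy ε => ?_
      rw [zero_smul, add_zero] at hy
      rw [dotProduct_add, dotProduct_smul, hu y hy, dotProduct_comm, (mem_exposedFace.1 hy).2]
      simp
    obtain ⟨r, hr, hp, hn⟩ := exists_pos_of_eventually_nhds_zero
      ((hev w hw).and (hev (-w) fun y hy => by rw [dotProduct_neg, hw y hy, neg_zero]))
    -- `v` is the midpoint of `v + r • w` and `v - r • w`, both in `K°`, so every face containing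
    -- `v` contains them.
    have hmem : v + r • w ∈ minimalFace (polarCone K) v := by
      refine mem_minimalFace.2 fun E hE hvE => hE.mem_of_add_mem_left hp hn ?_
      have : v + r • w + (v + r • -w) = (2 : ℝ) • v := by module
      rw [this]
      exact PointedCone.smul_mem E (by norm_num) hvE
    have hw' : w = r⁻¹ • ((v + r • w) - v) := by
      rw [add_sub_cancel_left, smul_smul, inv_mul_cancel₀ hr.ne', one_smul]
    rw [hw']
    exact Submodule.smul_mem _ _ (Submodule.sub_mem _ (Submodule.subset_span hmem)
      (Submodule.subset_span self_mem_minimalFace))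

/-! ## Positive semidefinite matrices -/

theorem trace_mul_vecMulVec {n : ℕ} (A : Matrix (Fin n) (Fin n) ℝ) (v : Fin n → ℝ) :
    (A * vecMulVec v v).trace = v ⬝ᵥ (A *ᵥ v) := by
  rw [mul_vecMulVec, trace_vecMulVec, dotProduct_comm]

theorem Matrix.PosDef.exists_mul_sq_norm_le {n : ℕ} {P : Matrix (Fin n) (Fin n) ℝ}
    (hP : P.PosDef) : ∃ c : ℝ, 0 < c ∧ ∀ x : Fin n → ℝ, c * ‖x‖ ^ 2 ≤ x ⬝ᵥ (P *ᵥ x) := by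
  have hcont : Continuous fun x : Fin n → ℝ => x ⬝ᵥ (P *ᵥ x) := by fun_prop
  rcases (Metric.sphere (0 : Fin n → ℝ) 1).eq_empty_or_nonempty with h | h
  · refine ⟨1, one_pos, fun x => ?_⟩
    have hx : x = 0 := by
      by_contra hx
      have : ‖x‖⁻¹ • x ∈ Metric.sphere (0 : Fin n → ℝ) 1 := by
        rw [mem_sphere_zero_iff_norm, norm_smul, norm_inv, norm_norm,
          inv_mul_cancel₀ (norm_ne_zero_iff.2 hx)]
      rw [h] at this
      exact this
    simp [hx]
  · obtain ⟨z, hz, hmin⟩ := (isCompact_sphere (0 : Fin n → ℝ) 1).exists_isMinOn h hcont.continuousOn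
    have hz0 : z ≠ 0 := by
      rintro rfl
      simp at hz
    refine ⟨z ⬝ᵥ (P *ᵥ z), by simpa using hP.dotProduct_mulVec_pos hz0, fun x => ?_⟩
    by_cases hx : x = 0
    · simp [hx]
    have hn : ‖x‖ ≠ 0 := norm_ne_zero_iff.2 hx
    have hmem : ‖x‖⁻¹ • x ∈ Metric.sphere (0 : Fin n → ℝ) 1 := by
      rw [mem_sphere_zero_iff_norm, norm_smul, norm_inv, norm_norm, inv_mul_cancel₀ hn]
    have h1 := hmin hmem
    simp only [Set.mem_ofPred_eq, mulVec_smul, dotProduct_smul, smul_dotProduct, smul_eq_mul] at h1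
    calc z ⬝ᵥ (P *ᵥ z) * ‖x‖ ^ 2
        ≤ (‖x‖⁻¹ * (‖x‖⁻¹ * x ⬝ᵥ (P *ᵥ x))) * ‖x‖ ^ 2 := by gcongr
      _ = x ⬝ᵥ (P *ᵥ x) := by field_simp

/-- Write `Y` as a sum of rank-one terms `v vᵀ`; each has entries at most `‖v‖²` and trace pairing
at least `c ‖v‖²`. -/
theorem Matrix.PosDef.exists_abs_entry_le {n : ℕ} {P : Matrix (Fin n) (Fin n) ℝ} (hP : P.PosDef) :
    ∃ c : ℝ, 0 < c ∧ ∀ Y : Matrix (Fin n) (Fin n) ℝ, Y.PosSemidef →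
      ∀ i j, c * |Y i j| ≤ (P * Y).trace := by
  obtain ⟨c, hc, h⟩ := hP.exists_mul_sq_norm_le
  refine ⟨c, hc, fun Y hY i j => ?_⟩
  obtain ⟨r, v, rfl⟩ := posSemidef_iff_eq_sum_vecMulVec.1 hY
  simp only [star_trivial, Finset.mul_sum, trace_sum, trace_mul_vecMulVec, sum_apply,
    vecMulVec_apply]
  calc c * |∑ k, v k i * v k j| ≤ c * ∑ k, |v k i * v k j| := by
        gcongr; exact Finset.abs_sum_le_sum_abs _ _
    _ = ∑ k, c * |v k i * v k j| := Finset.mul_sum _ _ _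
    _ ≤ ∑ k, v k ⬝ᵥ (P *ᵥ v k) := by
        refine Finset.sum_le_sum fun k _ => le_trans ?_ (h (v k))
        rw [abs_mul, sq]
        gcongr
        · exact norm_le_pi_norm (v k) i
        · exact norm_le_pi_norm (v k) j

theorem Matrix.PosSemidef.trace_mul_nonneg {n : ℕ} {A Y : Matrix (Fin n) (Fin n) ℝ}
    (hA : A.PosSemidef) (hY : Y.PosSemidef) : 0 ≤ (A * Y).trace := by
  obtain ⟨r, v, rfl⟩ := posSemidef_iff_eq_sum_vecMulVec.1 hY
  simp only [star_trivial, Finset.mul_sum, trace_sum, trace_mul_vecMulVec]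
  exact Finset.sum_nonneg fun k _ => by simpa using hA.dotProduct_mulVec_nonneg (v k)

theorem isClosed_setOf_posSemidef (n : ℕ) :
    IsClosed {Y : Matrix (Fin n) (Fin n) ℝ | Y.PosSemidef} := by
  have h : {Y : Matrix (Fin n) (Fin n) ℝ | Y.PosSemidef} =
      {Y | Yᴴ = Y} ∩ ⋂ x : Fin n → ℝ, {Y | 0 ≤ x ⬝ᵥ (Y *ᵥ x)} := by
    ext Y
    simp [posSemidef_iff_dotProduct_mulVec, IsHermitian]
  rw [h]
  exact (isClosed_eq (by fun_prop) continuous_id).inter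
    (isClosed_iInter fun x => isClosed_le continuous_const (by fun_prop))

/-- For positive definite `P`, the sets `{Y ⪰ 0 | ⟨P, Y⟩ ≤ M}` are compact. -/
theorem Matrix.PosDef.isCompact_trace_le {n : ℕ} {P : Matrix (Fin n) (Fin n) ℝ} (hP : P.PosDef)
    (M : ℝ) : IsCompact {Y : Matrix (Fin n) (Fin n) ℝ | Y.PosSemidef ∧ (P * Y).trace ≤ M} := by
  obtain ⟨c, hc, h⟩ := hP.exists_abs_entry_le
  have hK : IsCompact (Set.univ.pi fun _ => Set.univ.pi fun _ => Set.Icc (-(M / c)) (M / c) :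
      Set (Fin n → Fin n → ℝ)) :=
    isCompact_univ_pi fun _ => isCompact_univ_pi fun _ => isCompact_Icc
  have htr : Continuous fun Y : Matrix (Fin n) (Fin n) ℝ => (P * Y).trace := by fun_prop
  refine IsCompact.of_isClosed_subset hK
    ((isClosed_setOf_posSemidef n).inter (isClosed_le htr continuous_const)) ?_
  rintro Y ⟨hY, hYM⟩ i - j -
  have h1 : |Y i j| ≤ M / c := by
    rw [le_div_iff₀ hc, mul_comm]
    exact (h Y hY i j).trans hYM
  exact abs_le.1 h1

namespace QCQP

variable {n m : ℕ}

/-! ## Aggregation -/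

theorem dotProduct_aggA_mulVec (Q : QCQP n m) (γ : Fin (m + 1) → ℝ) (x y : Fin n → ℝ) :
    x ⬝ᵥ (Q.aggA γ *ᵥ y) = ∑ i, γ i * (x ⬝ᵥ (Q.A i *ᵥ y)) := by
  simp [aggA, sum_mulVec, smul_mulVec, dotProduct_sum, dotProduct_smul]

theorem aggb_dotProduct (Q : QCQP n m) (γ : Fin (m + 1) → ℝ) (x : Fin n → ℝ) :
    Q.aggb γ ⬝ᵥ x = ∑ i, γ i * (Q.b i ⬝ᵥ x) := by
  simp [aggb, sum_dotProduct, smul_dotProduct]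

theorem trace_aggA_mul (Q : QCQP n m) (γ : Fin (m + 1) → ℝ) (Y : Matrix (Fin n) (Fin n) ℝ) :
    (Q.aggA γ * Y).trace = ∑ i, γ i * (Q.A i * Y).trace := by
  simp [aggA, Finset.sum_mul, trace_sum]

theorem aggA_isSymm (Q : QCQP n m) (γ : Fin (m + 1) → ℝ) : (Q.aggA γ).IsSymm := by
  simp only [aggA, IsSymm, transpose_sum, transpose_smul]
  exact Finset.sum_congr rfl fun i _ => by rw [(Q.A_symm i).eq]

theorem dotProduct_eObj (γ : Fin (m + 1) → ℝ) : γ ⬝ᵥ eObj = γ 0 := by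
  simp [eObj]

/-- The coefficient of `α` in `slack (x + α x') (t + α t')`. -/
def slackLin (Q : QCQP n m) (x : Fin n → ℝ) (d : (Fin n → ℝ) × ℝ) : Fin (m + 1) → ℝ :=
  (2 : ℝ) • ((fun i => x ⬝ᵥ (Q.A i *ᵥ d.1) + Q.b i ⬝ᵥ d.1) - d.2 • eObj)

/-- The coefficient of `α²` in `slack (x + α x') (t + α t')`. -/
def slackQuad (Q : QCQP n m) (d : (Fin n → ℝ) × ℝ) : Fin (m + 1) → ℝ :=
  fun i => d.1 ⬝ᵥ (Q.A i *ᵥ d.1)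

theorem slack_add_smul (Q : QCQP n m) (x : Fin n → ℝ) (t : ℝ) (d : (Fin n → ℝ) × ℝ) (α : ℝ) :
    Q.slack (x + α • d.1) (t + α * d.2) =
      Q.slack x t + α • Q.slackLin x d + α ^ 2 • Q.slackQuad d := by
  ext i
  have hs : d.1 ⬝ᵥ (Q.A i *ᵥ x) = x ⬝ᵥ (Q.A i *ᵥ d.1) := by
    rw [dotProduct_mulVec, ← mulVec_transpose, (Q.A_symm i).eq, dotProduct_comm]
  simp only [slack, slackLin, slackQuad, q, Pi.add_apply, Pi.sub_apply, Pi.smul_apply, smul_eq_mul,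
    mulVec_add, mulVec_smul, dotProduct_add, add_dotProduct, dotProduct_smul, smul_dotProduct, hs]
  ring

theorem dotProduct_slackLin (Q : QCQP n m) (γ : Fin (m + 1) → ℝ) (x : Fin n → ℝ)
    (d : (Fin n → ℝ) × ℝ) :
    γ ⬝ᵥ Q.slackLin x d = 2 * (x ⬝ᵥ (Q.aggA γ *ᵥ d.1) + Q.aggb γ ⬝ᵥ d.1 - d.2 * γ 0) := by
  rw [slackLin, dotProduct_smul, dotProduct_sub, dotProduct_smul, dotProduct_eObj,
    dotProduct_aggA_mulVec, aggb_dotProduct, ← Finset.sum_add_distrib]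
  simp [dotProduct, mul_add]

theorem dotProduct_slackQuad (Q : QCQP n m) (γ : Fin (m + 1) → ℝ) (d : (Fin n → ℝ) × ℝ) :
    γ ⬝ᵥ Q.slackQuad d = d.1 ⬝ᵥ (Q.aggA γ *ᵥ d.1) := by
  rw [dotProduct_aggA_mulVec]; rfl

theorem dotProduct_slackQuad_nonneg (Q : QCQP n m) {γ : Fin (m + 1) → ℝ} (hγ : γ ∈ Q.Gam)
    (d : (Fin n → ℝ) × ℝ) : 0 ≤ γ ⬝ᵥ Q.slackQuad d := by
  rw [dotProduct_slackQuad]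
  simpa using hγ.2.dotProduct_mulVec_nonneg d.1

theorem mem_S_iff (Q : QCQP n m) {p : (Fin n → ℝ) × ℝ} :
    p ∈ Q.S ↔ ∀ i, Q.slack p.1 p.2 i ≤ 0 := by
  rw [Fin.forall_fin_succ]
  simp [S, slack, eObj]

/-! ## The dual description of the relaxation -/

/-- The substitution `Y = X - x xᵀ` moves the quadratic part into the slack. -/
theorem mem_SDP_iff_exists (Q : QCQP n m) {p : (Fin n → ℝ) × ℝ} :
    p ∈ Q.SDP ↔ ∃ Y : Matrix (Fin n) (Fin n) ℝ, Y.PosSemidef ∧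
      ∀ i, (Q.A i * Y).trace ≤ -Q.slack p.1 p.2 i := by
  have htr : ∀ X : Matrix (Fin n) (Fin n) ℝ, ∀ i, (Q.A i * (X - vecMulVec p.1 p.1)).trace =
      ((Q.A i)ᵀ * X).trace - p.1 ⬝ᵥ (Q.A i *ᵥ p.1) := by
    intro X i
    rw [mul_sub, trace_sub, trace_mul_vecMulVec, (Q.A_symm i).eq]
  have hiff : ∀ X : Matrix (Fin n) (Fin n) ℝ,
      (∀ i, (Q.A i * (X - vecMulVec p.1 p.1)).trace ≤ -Q.slack p.1 p.2 i) ↔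
      ((Q.A 0)ᵀ * X).trace + 2 * (Q.b 0 ⬝ᵥ p.1) + Q.c 0 ≤ 2 * p.2 ∧
      ∀ i : Fin m, ((Q.A i.succ)ᵀ * X).trace + 2 * (Q.b i.succ ⬝ᵥ p.1) + Q.c i.succ ≤ 0 := by
    intro X
    rw [Fin.forall_fin_succ]
    simp only [htr, slack, q, eObj, Pi.sub_apply, Pi.smul_apply, Pi.single_eq_same, smul_eq_mul,
      Pi.single_eq_of_ne (Fin.succ_ne_zero _), mul_zero, mul_one, sub_zero]
    refine and_congr ⟨fun h => by linarith, fun h => by linarith⟩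
      (forall_congr' fun i => ⟨fun h => by linarith, fun h => by linarith⟩)
  constructor
  · rintro ⟨X, hX, h⟩
    exact ⟨_, hX, (hiff X).2 h⟩
  · rintro ⟨Y, hY, h⟩
    have hY' : Y + vecMulVec p.1 p.1 - vecMulVec p.1 p.1 = Y := add_sub_cancel_right _ _
    exact ⟨Y + vecMulVec p.1 p.1, by rwa [hY'], (hiff _).1 (by rwa [hY'])⟩

/-- The cone `{w | ∃ Y ⪰ 0, ⟨Aᵢ, Y⟩ ≤ wᵢ for all i}`, whose dual is `Γ`. -/
def momentCone (Q : QCQP n m) : Set (Fin (m + 1) → ℝ) :=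
  {w | ∃ Y : Matrix (Fin n) (Fin n) ℝ, Y.PosSemidef ∧ ∀ i, (Q.A i * Y).trace ≤ w i}

theorem add_mem_momentCone (Q : QCQP n m) {v w : Fin (m + 1) → ℝ} (hv : v ∈ Q.momentCone)
    (hw : w ∈ Q.momentCone) : v + w ∈ Q.momentCone := by
  obtain ⟨Y, hY, h⟩ := hv
  obtain ⟨Z, hZ, h'⟩ := hw
  exact ⟨Y + Z, hY.add hZ, fun i => by
    rw [mul_add, trace_add]; exact add_le_add (h i) (h' i)⟩

theorem smul_mem_momentCone (Q : QCQP n m) {v : Fin (m + 1) → ℝ} (hv : v ∈ Q.momentCone) {c : ℝ}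
    (hc : 0 ≤ c) : c • v ∈ Q.momentCone := by
  obtain ⟨Y, hY, h⟩ := hv
  exact ⟨c • Y, hY.smul hc, fun i => by
    rw [Matrix.mul_smul, trace_smul]; exact mul_le_mul_of_nonneg_left (h i) hc⟩

theorem zero_mem_momentCone (Q : QCQP n m) : (0 : Fin (m + 1) → ℝ) ∈ Q.momentCone :=
  ⟨0, PosSemidef.zero, fun i => by simp⟩

theorem trace_aggA_mul_le (Q : QCQP n m) {γ w : Fin (m + 1) → ℝ} (hγ : γ ∈ Q.Gam)
    {Y : Matrix (Fin n) (Fin n) ℝ} (h : ∀ i, (Q.A i * Y).trace ≤ w i) :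
    (Q.aggA γ * Y).trace ≤ γ ⬝ᵥ w := by
  rw [trace_aggA_mul]
  exact Finset.sum_le_sum fun i _ => mul_le_mul_of_nonneg_left (h i) (hγ.1 i)

/-- Pairing a convergent sequence with the positive definite aggregate bounds the matrices `Y`, so a
subsequence converges. -/
theorem isClosed_momentCone (Q : QCQP n m) (hdef : Q.DualStrictlyFeasible) :
    IsClosed Q.momentCone := by
  obtain ⟨γ, hγ, hP⟩ := hdef
  refine IsSeqClosed.isClosed fun w w₀ hw hlim => ?_
  choose Y hY hYw using hw
  have hdot : Filter.Tendsto (fun k => γ ⬝ᵥ w k) Filter.atTop (nhds (γ ⬝ᵥ w₀)) :=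
    ((by fun_prop : Continuous fun u : Fin (m + 1) → ℝ => γ ⬝ᵥ u).tendsto w₀).comp hlim
  obtain ⟨M, hM⟩ := hdot.bddAbove_range
  have hmem : ∀ k, Y k ∈ {Y : Matrix (Fin n) (Fin n) ℝ | Y.PosSemidef ∧
      (Q.aggA γ * Y).trace ≤ M} := fun k =>
    ⟨hY k, (Q.trace_aggA_mul_le hγ (hYw k)).trans (hM ⟨k, rfl⟩)⟩
  have : FirstCountableTopology (Matrix (Fin n) (Fin n) ℝ) :=
    inferInstanceAs (FirstCountableTopology (Fin n → Fin n → ℝ))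
  obtain ⟨Y₀, hY₀, φ, hφ, hconv⟩ := (hP.isCompact_trace_le M).tendsto_subseq hmem
  refine ⟨Y₀, hY₀.1, fun i => ?_⟩
  have h1 : Filter.Tendsto (fun k => (Q.A i * Y (φ k)).trace) Filter.atTop
      (nhds (Q.A i * Y₀).trace) :=
    ((by fun_prop : Continuous fun Z : Matrix (Fin n) (Fin n) ℝ =>
      (Q.A i * Z).trace).tendsto Y₀).comp hconv
  have h2 : Filter.Tendsto (fun k => w (φ k) i) Filter.atTop (nhds (w₀ i)) :=
    ((tendsto_pi_nhds.1 hlim) i).comp hφ.tendsto_atTop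
  exact le_of_tendsto_of_tendsto' h1 h2 fun k => hYw (φ k) i

/-- A functional separating `w` from the closed cone is an element of `Γ`: unit vectors (with `Y =
0`) show its coordinates are nonnegative, and `Y = x xᵀ` shows the aggregate is semidefinite. -/
theorem mem_momentCone_of_forall (Q : QCQP n m) (hdef : Q.DualStrictlyFeasible)
    {w : Fin (m + 1) → ℝ} (hw : ∀ γ ∈ Q.Gam, 0 ≤ γ ⬝ᵥ w) : w ∈ Q.momentCone := by
  by_contra hcon
  have hconv : Convex ℝ Q.momentCone := fun u hu v hv a b ha hb _ =>
    Q.add_mem_momentCone (Q.smul_mem_momentCone hu ha) (Q.smul_mem_momentCone hv hb)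
  obtain ⟨φ, u, hφw, hφ⟩ :=
    geometric_hahn_banach_point_closed hconv (Q.isClosed_momentCone hdef) hcon
  have hu : u < 0 := by simpa using hφ 0 Q.zero_mem_momentCone
  have hpos : ∀ v ∈ Q.momentCone, 0 ≤ φ v := by
    intro v hv
    by_contra hneg
    push Not at hneg
    have h1 := hφ _ (Q.smul_mem_momentCone hv (c := u / φ v)
      (div_nonneg_of_nonpos hu.le hneg.le))
    rw [map_smul, smul_eq_mul, div_mul_cancel₀ _ hneg.ne] at h1
    exact lt_irrefl _ h1
  set γ : Fin (m + 1) → ℝ := fun i => φ (Pi.single i 1) with hγdef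
  have hrep : ∀ v, φ v = γ ⬝ᵥ v := by
    intro v
    conv_lhs => rw [← Finset.univ_sum_single v, map_sum]
    refine Finset.sum_congr rfl fun i _ => ?_
    have : Pi.single i (v i) = v i • (Pi.single i (1 : ℝ) : Fin (m + 1) → ℝ) := by
      rw [← Pi.single_smul]; simp
    rw [this, map_smul, smul_eq_mul, mul_comm]
  have hγ : γ ∈ Q.Gam := by
    refine ⟨fun i => hpos _ ⟨0, PosSemidef.zero, fun j => ?_⟩, ?_⟩
    · rw [mul_zero, trace_zero, Pi.single_apply]
      split_ifs <;> norm_num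
    · refine PosSemidef.of_dotProduct_mulVec_nonneg (Q.aggA_isSymm γ) fun x => ?_
      have hx : (fun i => x ⬝ᵥ (Q.A i *ᵥ x)) ∈ Q.momentCone :=
        ⟨vecMulVec x x, by simpa using posSemidef_vecMulVec_self_star x,
          fun i => (trace_mul_vecMulVec _ _).le⟩
      have := hpos _ hx
      rw [hrep] at this
      rw [star_trivial, dotProduct_aggA_mulVec]
      exact this
  have h1 := hw γ hγ
  rw [← hrep] at h1
  linarith

/-- Strong duality: `(x, t) ∈ S_SDP` if and only if `q(x) - 2 t e_obj ∈ Γ°`. -/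
theorem mem_SDP_iff (Q : QCQP n m) (hdef : Q.DualStrictlyFeasible) {p : (Fin n → ℝ) × ℝ} :
    p ∈ Q.SDP ↔ Q.slack p.1 p.2 ∈ polarCone Q.Gam := by
  rw [mem_SDP_iff_exists, mem_polarCone]
  constructor
  · rintro ⟨Y, hY, h⟩ γ hγ
    have h1 := hγ.2.trace_mul_nonneg hY
    have h2 := Q.trace_aggA_mul_le (w := -Q.slack p.1 p.2) hγ h
    rw [dotProduct_neg] at h2
    linarith
  · intro h
    exact Q.mem_momentCone_of_forall hdef (w := -Q.slack p.1 p.2)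
      fun γ hγ => by rw [dotProduct_neg]; linarith [h γ hγ]

end QCQP

namespace QCQP

variable {n m : ℕ}

/-! ### Directions along which the slack stays orthogonal to a face -/

theorem one_cons_zero (γ : Fin m → ℝ) : (one_cons γ : Fin (m + 1) → ℝ) 0 = 1 := by
  simp [one_cons]

theorem dotProduct_slack_add_smul (Q : QCQP n m) (γ : Fin (m + 1) → ℝ) (p d : (Fin n → ℝ) × ℝ)
    (α : ℝ) : γ ⬝ᵥ Q.slack (p + α • d).1 (p + α • d).2 =
      γ ⬝ᵥ Q.slack p.1 p.2 + α * γ ⬝ᵥ Q.slackLin p.1 d + α ^ 2 * γ ⬝ᵥ Q.slackQuad d := by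
  have h := Q.slack_add_smul p.1 p.2 d α
  simp only [Prod.fst_add, Prod.smul_fst, Prod.snd_add, Prod.smul_snd, smul_eq_mul, h,
    dotProduct_add, dotProduct_smul]

theorem continuous_slack_add_smul (Q : QCQP n m) (p d : (Fin n → ℝ) × ℝ) :
    Continuous fun α : ℝ => Q.slack (p + α • d).1 (p + α • d).2 := by
  have h := Q.slack_add_smul p.1 p.2 d
  simp only [Prod.fst_add, Prod.smul_fst, Prod.snd_add, Prod.smul_snd, smul_eq_mul, h]
  fun_prop

theorem exists_one_cons_smul_mem {F : PointedCone ℝ (Fin (m + 1) → ℝ)} {y : Fin (m + 1) → ℝ}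
    (hy : y ∈ F) (h0 : 0 < y 0) : ∃ γ : Fin m → ℝ, one_cons γ = (y 0)⁻¹ • y ∧ one_cons γ ∈ F := by
  obtain ⟨γ, hγ⟩ := exists_one_cons_eq (y := (y 0)⁻¹ • y) (by simp [h0.ne'])
  exact ⟨γ, hγ, hγ ▸ PointedCone.smul_mem F (inv_nonneg.2 h0.le) hy⟩

/-- The directions `D(F, f)` are those along which all `⟨γ, q(x) - 2 t e_obj⟩`, `γ ∈ F`, are
constant. -/
theorem mem_faceDirections_iff (Q : QCQP n m) {F : PointedCone ℝ (Fin (m + 1) → ℝ)}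
    (hF : F ≤ Q.Gam) {f : Fin m → ℝ}
    (hf : one_cons f ∈ intrinsicInterior ℝ (F : Set (Fin (m + 1) → ℝ))) (x : Fin n → ℝ)
    {d : (Fin n → ℝ) × ℝ} :
    d ∈ Q.faceDirections F f ↔
      ∀ γ ∈ F, γ ⬝ᵥ Q.slackLin x d = 0 ∧ γ ⬝ᵥ Q.slackQuad d = 0 := by
  have hfF : one_cons f ∈ F := intrinsicInterior_subset hf
  have hker : ∀ γ ∈ F, γ ⬝ᵥ Q.slackQuad d = 0 → Q.aggA γ *ᵥ d.1 = 0 := by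
    intro γ hγ h
    rw [dotProduct_slackQuad] at h
    exact ((hF hγ).2.dotProduct_mulVec_zero_iff d.1).1 (by simpa using h)
  constructor
  · rintro ⟨hd, hb⟩
    have hfq : one_cons f ⬝ᵥ Q.slackQuad d = 0 := by
      rw [dotProduct_slackQuad, hd, dotProduct_zero]
    -- A nonnegative linear functional on `F` that vanishes at a relative interior point vanishes on
    -- all of `F`.
    have hquad : ∀ γ ∈ F, γ ⬝ᵥ Q.slackQuad d = 0 := by
      intro γ hγ
      obtain ⟨ε, hε, h⟩ := exists_sub_smul_mem_of_mem_intrinsicInterior hf hγ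
      have h1 := Q.dotProduct_slackQuad_nonneg (hF h) d
      rw [sub_dotProduct, smul_dotProduct, sub_dotProduct, hfq, smul_eq_mul] at h1
      have h2 := Q.dotProduct_slackQuad_nonneg (hF hγ) d
      nlinarith
    have hone : ∀ γ : Fin m → ℝ, one_cons γ ∈ F → one_cons γ ⬝ᵥ Q.slackLin x d = 0 := by
      intro γ hγ
      rw [dotProduct_slackLin, hker _ hγ (hquad _ hγ), one_cons_zero, dotProduct_zero, zero_add,
        mul_one, hb γ hγ, mul_zero]
    refine fun γ hγ => ⟨?_, hquad γ hγ⟩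
    -- `γ 0` may be zero; adding `(1, f)` allows normalization.
    have hpos : 0 < (γ + one_cons f) 0 := by
      rw [Pi.add_apply, one_cons_zero]
      linarith [(hF hγ).1 0]
    obtain ⟨δ, hδ, hδF⟩ := exists_one_cons_smul_mem (add_mem hγ hfF) hpos
    have h1 := hone δ hδF
    rw [hδ, smul_dotProduct, add_dotProduct, hone f hfF, add_zero, smul_eq_mul] at h1
    exact (mul_eq_zero.1 h1).resolve_left (inv_ne_zero hpos.ne')
  · intro h
    refine ⟨hker _ hfF (h _ hfF).2, fun γ hγ => ?_⟩
    have h1 := (h _ hγ).1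
    rw [dotProduct_slackLin, hker _ hγ (h _ hγ).2, one_cons_zero, dotProduct_zero, zero_add,
      mul_one] at h1
    linarith

/-- The slack is quadratic in `α` with constant term in the span; its values at `α = 1` and `α = -1`
recover the other two coefficients. -/
theorem mem_R'_iff (Q : QCQP n m) {x : Fin n → ℝ} {t : ℝ} {d : (Fin n → ℝ) × ℝ} :
    d ∈ Q.R' x t ↔
      Q.slackLin x d ∈ Submodule.span ℝ (Q.faceG x t : Set (Fin (m + 1) → ℝ)) ∧
      Q.slackQuad d ∈ Submodule.span ℝ (Q.faceG x t : Set (Fin (m + 1) → ℝ)) := by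
  set V := Submodule.span ℝ (Q.faceG x t : Set (Fin (m + 1) → ℝ)) with hV
  have h0 : Q.slack x t ∈ V := Submodule.subset_span self_mem_minimalFace
  change (∀ α : ℝ, Q.slack (x + α • d.1) (t + α * d.2) ∈ V) ↔ _
  simp only [slack_add_smul]
  constructor
  · intro h
    have h1 := V.sub_mem (h 1) h0
    have h2 := V.sub_mem (h (-1)) h0
    constructor
    · convert V.smul_mem (1 / 2 : ℝ) (V.sub_mem h1 h2) using 1; module
    · convert V.smul_mem (1 / 2 : ℝ) (V.add_mem h1 h2) using 1; module
  · rintro ⟨h1, h2⟩ α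
    exact V.add_mem (V.add_mem h0 (V.smul_mem _ h1)) (V.smul_mem _ h2)

theorem slack_sub (Q : QCQP n m) (x : Fin n → ℝ) (t s : ℝ) :
    Q.slack x (t - s) = Q.slack x t + (2 * s) • eObj := by
  rw [slack, slack]; module

/-- If no `(1, γ)` is in the face of `Γ` exposed by `q(x) - 2 t e_obj`, then `t` can be
decreased. -/
theorem exists_slack_sub_mem_polarCone (Q : QCQP n m) (hpoly : IsPolyhedralCone Q.Gam)
    {x : Fin n → ℝ} {t : ℝ} (h : Q.slack x t ∈ polarCone Q.Gam)
    (hF : ∀ γ : Fin m → ℝ, one_cons γ ∉ exposedFace Q.Gam (Q.slack x t)) :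
    ∃ s : ℝ, 0 < s ∧ Q.slack x (t - s) ∈ polarCone Q.Gam := by
  refine exists_pos_of_eventually_nhds_zero
    (eventually_mem_polarCone hpoly (c := fun s => Q.slack x (t - s)) ?_ (by simpa using h) ?_)
  · simp only [slack_sub]; fun_prop
  · intro y hy s
    rw [sub_zero] at hy
    have hy0 : y 0 = 0 := by
      refine le_antisymm (not_lt.1 fun hpos => ?_) ((mem_exposedFace.1 hy).1.1 0)
      obtain ⟨γ, -, hγ⟩ := exists_one_cons_smul_mem hy hpos
      exact hF γ hγ
    rw [slack_sub, dotProduct_add, dotProduct_smul, dotProduct_eObj, hy0, dotProduct_comm,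
      (mem_exposedFace.1 hy).2]
    simp

/-- Otherwise `t` could be decreased within `Γ°`, giving a smaller upper bound than the supremum. -/
theorem EpigraphTight.exists_mem_exposedFace {Q : QCQP n m} (hpoly : IsPolyhedralCone Q.Gam)
    {x : Fin n → ℝ} {t : ℝ} (h : Q.slack x t ∈ polarCone Q.Gam) (ht : Q.EpigraphTight x t) :
    ∃ γ : Fin m → ℝ, one_cons γ ∈ exposedFace Q.Gam (Q.slack x t) := by
  by_contra! hcon
  obtain ⟨s, hs, hmem⟩ := Q.exists_slack_sub_mem_polarCone hpoly h hcon
  have hub : 2 * (t - s) ∈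
      upperBounds ((fun γ : Fin m → ℝ => one_cons γ ⬝ᵥ Q.q x) '' Q.Gam₁) := by
    rintro _ ⟨γ, hγ, rfl⟩
    have hγ' : one_cons γ ∈ Q.Gam := by
      refine ⟨?_, hγ.2⟩
      rw [Fin.forall_fin_succ]
      simpa [one_cons] using hγ.1
    have h1 := mem_polarCone.1 hmem _ hγ'
    rw [slack, dotProduct_sub, dotProduct_smul, dotProduct_eObj, one_cons_zero, smul_eq_mul,
      mul_one] at h1
    change one_cons γ ⬝ᵥ Q.q x ≤ _
    linarith
  have := ht.2 hub
  linarith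

theorem exposedFace_le (Q : QCQP n m) (v : Fin (m + 1) → ℝ) : exposedFace Q.Gam v ≤ Q.Gam :=
  fun _ hy => (mem_exposedFace.1 hy).1

theorem R'_eq_faceDirections (Q : QCQP n m) (hpoly : IsPolyhedralCone Q.Gam) {x : Fin n → ℝ}
    {t : ℝ} (h : Q.slack x t ∈ polarCone Q.Gam) {f : Fin m → ℝ}
    (hf : one_cons f ∈ intrinsicInterior ℝ
      (exposedFace Q.Gam (Q.slack x t) : Set (Fin (m + 1) → ℝ))) :
    Q.R' x t = Q.faceDirections (exposedFace Q.Gam (Q.slack x t)) f := by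
  ext d
  rw [mem_R'_iff, Q.mem_faceDirections_iff (Q.exposedFace_le _) hf x, faceG,
    mem_span_minimalFace_iff hpoly h, mem_span_minimalFace_iff hpoly h]
  exact ⟨fun h γ hγ => ⟨h.1 γ hγ, h.2 γ hγ⟩, fun h => ⟨fun γ hγ => (h γ hγ).1, fun γ hγ => (h γ hγ).2⟩⟩

/-! ## Convex hull exactness -/

theorem convex_SDP (Q : QCQP n m) (hdef : Q.DualStrictlyFeasible) : Convex ℝ Q.SDP := by
  intro u hu v hv a b ha hb hab
  rw [Q.mem_SDP_iff hdef, mem_polarCone] at hu hv ⊢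
  intro γ hγ
  have h0 := hu γ hγ
  have h1 := hv γ hγ
  have hv' : v = u + (1 : ℝ) • (v - u) := by module
  have hc : a • u + b • v = u + b • (v - u) := by
    rw [← eq_sub_iff_add_eq] at hab
    rw [hab]; module
  rw [hv', dotProduct_slack_add_smul] at h1
  rw [hc, dotProduct_slack_add_smul]
  have h2 := Q.dotProduct_slackQuad_nonneg hγ (v - u)
  have hb1 : b ≤ 1 := by linarith
  -- A quadratic with leading coefficient `w` lies below its chord on `[0, 1]` by `b (1 - b) w`.
  nlinarith [mul_nonneg (mul_nonneg hb (sub_nonneg.2 hb1)) h2]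

theorem S_subset_SDP (Q : QCQP n m) : Q.S ⊆ Q.SDP := fun p hp =>
  Q.mem_SDP_iff_exists.2 ⟨0, PosSemidef.zero, fun i => by
    have := Q.mem_S_iff.1 hp i
    rw [mul_zero, trace_zero]; linarith⟩

theorem add_mem_convexHull_S (Q : QCQP n m) {p : (Fin n → ℝ) × ℝ} (hp : p ∈ convexHull ℝ Q.S)
    {s : ℝ} (hs : 0 ≤ s) : p + (0, s) ∈ convexHull ℝ Q.S := by
  have hconv : Convex ℝ ((fun p : (Fin n → ℝ) × ℝ => p + (0, s)) ⁻¹' convexHull ℝ Q.S) :=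
    (convex_convexHull ℝ Q.S).translate_preimage_left _
  have hsub : Q.S ⊆ (fun p : (Fin n → ℝ) × ℝ => p + (0, s)) ⁻¹' convexHull ℝ Q.S := by
    refine fun p hp => subset_convexHull ℝ Q.S ⟨?_, fun i => ?_⟩
    · have := hp.1
      simp only [Prod.fst_add, Prod.snd_add, add_zero]
      linarith
    · simpa using hp.2 i
  exact convexHull_min hsub hconv hp

/-- Along a direction in which `S_SDP` is bounded there is a last point of `S_SDP`. -/
theorem exists_last_mem_SDP (Q : QCQP n m) (hdef : Q.DualStrictlyFeasible)
    {p d : (Fin n → ℝ) × ℝ} (hp : p ∈ Q.SDP) (hbdd : BddAbove {α : ℝ | p + α • d ∈ Q.SDP}) :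
    ∃ α : ℝ, 0 ≤ α ∧ p + α • d ∈ Q.SDP ∧ ∀ ε : ℝ, 0 < ε → p + (α + ε) • d ∉ Q.SDP := by
  have hclosed : IsClosed {α : ℝ | p + α • d ∈ Q.SDP} := by
    have h : {α : ℝ | p + α • d ∈ Q.SDP} =
        ⋂ γ ∈ Q.Gam, {α : ℝ | γ ⬝ᵥ Q.slack (p + α • d).1 (p + α • d).2 ≤ 0} := by
      ext α
      simp only [Q.mem_SDP_iff hdef, mem_polarCone, Set.mem_iInter, Set.mem_ofPred_eq]
    rw [h]
    have hcont := Q.continuous_slack_add_smul p d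
    exact isClosed_biInter fun γ _ => isClosed_le (by fun_prop) continuous_const
  have hne : {α : ℝ | p + α • d ∈ Q.SDP}.Nonempty := ⟨0, by simpa using hp⟩
  refine ⟨sSup {α : ℝ | p + α • d ∈ Q.SDP}, le_csSup hbdd (by simpa using hp),
    hclosed.csSup_mem hne hbdd, fun ε hε h => ?_⟩
  linarith [le_csSup hbdd h]

theorem bddAbove_of_dotProduct (Q : QCQP n m) (hdef : Q.DualStrictlyFeasible)
    {p d : (Fin n → ℝ) × ℝ} {γ : Fin (m + 1) → ℝ} (hγ : γ ∈ Q.Gam)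
    (h : 0 < γ ⬝ᵥ Q.slackQuad d ∨ γ ⬝ᵥ Q.slackQuad d = 0 ∧ 0 < γ ⬝ᵥ Q.slackLin p.1 d) :
    BddAbove {α : ℝ | p + α • d ∈ Q.SDP} := by
  have hle : ∀ α : ℝ, p + α • d ∈ Q.SDP → γ ⬝ᵥ Q.slack p.1 p.2 + α * γ ⬝ᵥ Q.slackLin p.1 d +
      α ^ 2 * γ ⬝ᵥ Q.slackQuad d ≤ 0 := by
    intro α hα
    rw [← dotProduct_slack_add_smul]
    exact mem_polarCone.1 ((Q.mem_SDP_iff hdef).1 hα) γ hγ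
  generalize γ ⬝ᵥ Q.slack p.1 p.2 = c at hle
  generalize γ ⬝ᵥ Q.slackLin p.1 d = l at hle h
  generalize γ ⬝ᵥ Q.slackQuad d = r at hle h
  rcases h with hr | ⟨rfl, hl⟩
  -- Beyond this bound `α > 1` and `l + α r > |c|`, so `c + α (l + α r) > 0`.
  · refine ⟨(|c| + |l|) / r + 1, fun α hα => ?_⟩
    by_contra! hlt
    have h1 := hle α hα
    have hq : 0 ≤ (|c| + |l|) / r := by positivity
    have h2 : |c| + |l| < α * r := (div_lt_iff₀ hr).1 (by linarith)
    have h3 : |c| ≤ l + α * r := by linarith [neg_abs_le l]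
    nlinarith [neg_abs_le c, abs_nonneg c, neg_abs_le l]
  · refine ⟨-c / l, fun α hα => ?_⟩
    rw [le_div_iff₀ hl]
    linarith [hle α hα]

/-- The last point of `S_SDP` in a direction of `D` exposes a larger face of `Γ`. -/
theorem exists_mem_SDP_exposedFace_lt (Q : QCQP n m) (hdef : Q.DualStrictlyFeasible)
    (hpoly : IsPolyhedralCone Q.Gam) {p d : (Fin n → ℝ) × ℝ} (hp : p ∈ Q.SDP) (hd : d.1 ≠ 0)
    (hdF : ∀ γ ∈ exposedFace Q.Gam (Q.slack p.1 p.2),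
      γ ⬝ᵥ Q.slackLin p.1 d = 0 ∧ γ ⬝ᵥ Q.slackQuad d = 0) :
    ∃ α : ℝ, 0 ≤ α ∧ p + α • d ∈ Q.SDP ∧ exposedFace Q.Gam (Q.slack p.1 p.2) <
      exposedFace Q.Gam (Q.slack (p + α • d).1 (p + α • d).2) := by
  obtain ⟨γ, hγ, hpd⟩ := id hdef
  have hbdd : BddAbove {α : ℝ | p + α • d ∈ Q.SDP} := by
    refine Q.bddAbove_of_dotProduct hdef hγ (Or.inl ?_)
    rw [dotProduct_slackQuad]
    simpa using hpd.dotProduct_mulVec_pos hd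
  obtain ⟨α, hα, hmem, hlast⟩ := Q.exists_last_mem_SDP hdef hp hbdd
  have hconst : ∀ γ ∈ exposedFace Q.Gam (Q.slack p.1 p.2), ∀ β : ℝ,
      γ ⬝ᵥ Q.slack (p + β • d).1 (p + β • d).2 = 0 := by
    intro γ hγ β
    rw [dotProduct_slack_add_smul, (hdF γ hγ).1, (hdF γ hγ).2, dotProduct_comm,
      (mem_exposedFace.1 hγ).2]
    simp
  have hle : exposedFace Q.Gam (Q.slack p.1 p.2) ≤
      exposedFace Q.Gam (Q.slack (p + α • d).1 (p + α • d).2) := fun γ hγ =>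
    mem_exposedFace.2 ⟨(mem_exposedFace.1 hγ).1, by rw [dotProduct_comm, hconst γ hγ]⟩
  -- Were the face unchanged, the line would still be orthogonal to it at the exit and could be
  -- continued.
  refine ⟨α, hα, hmem, lt_of_le_of_ne hle fun heq => ?_⟩
  obtain ⟨ε, hε, h⟩ := exists_pos_of_eventually_nhds_zero
    (eventually_mem_polarCone hpoly
      (c := fun ε => Q.slack (p + (α + ε) • d).1 (p + (α + ε) • d).2)
      ((Q.continuous_slack_add_smul p d).comp (continuous_const.add continuous_id))
      (by rw [add_zero]; exact (Q.mem_SDP_iff hdef).1 hmem)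
      (fun y hy ε => by
        rw [add_zero, ← heq] at hy
        exact hconst y hy _))
  exact hlast ε hε ((Q.mem_SDP_iff hdef).2 h)

/-- An exposed face is recovered from its span by intersecting with `K`. Passing to subspaces of a
finite-dimensional space makes the induction on growing faces well-founded. -/
theorem span_exposedFace_lt {k : ℕ} {K : PointedCone ℝ (Fin k → ℝ)} {v w : Fin k → ℝ}
    (h : exposedFace K v < exposedFace K w) :
    Submodule.span ℝ (exposedFace K v : Set (Fin k → ℝ)) <
      Submodule.span ℝ (exposedFace K w : Set (Fin k → ℝ)) := by
  refine lt_of_le_not_ge (Submodule.span_mono h.le) fun hle => h.not_ge fun y hy => ?_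
  have hsub : Submodule.span ℝ (exposedFace K v : Set (Fin k → ℝ)) ≤ orthCompl {v} :=
    Submodule.span_le.2 fun x hx => hx.2
  exact ⟨hy.1, hsub (hle (Submodule.subset_span hy))⟩

/-- If `γ 0 = 0` on all of `Γ`, duality yields `Y ⪰ 0` for the right-hand side `-e_obj`. Pairing
with the positive definite aggregate forces `Y = 0`, so `0 ≤ -1`. -/
theorem exists_one_cons_mem_Gam (Q : QCQP n m) (hdef : Q.DualStrictlyFeasible) :
    ∃ γ : Fin m → ℝ, one_cons γ ∈ Q.Gam := by
  by_contra! hcon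
  have hzero : ∀ γ ∈ Q.Gam, γ 0 = 0 := by
    intro γ hγ
    refine le_antisymm (not_lt.1 fun hpos => ?_) (hγ.1 0)
    obtain ⟨δ, -, hδ⟩ := exists_one_cons_smul_mem hγ hpos
    exact hcon δ hδ
  obtain ⟨Y, hY, h⟩ := Q.mem_momentCone_of_forall hdef (w := -eObj) fun γ hγ => by
    rw [dotProduct_neg, dotProduct_eObj, hzero γ hγ, neg_zero]
  obtain ⟨γ, hγ, hpd⟩ := hdef
  have htr := Q.trace_aggA_mul_le hγ h
  rw [dotProduct_neg, dotProduct_eObj, hzero γ hγ, neg_zero] at htr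
  obtain ⟨c, hc, hent⟩ := hpd.exists_abs_entry_le
  have hY0 : Y = 0 := by
    ext i j
    have h1 := (hent Y hY i j).trans htr
    exact abs_nonpos_iff.1 (nonpos_of_mul_nonpos_right h1 hc)
  have h0 := h 0
  rw [hY0, mul_zero, trace_zero, Pi.neg_apply, eObj, Pi.single_eq_same] at h0
  linarith

/-- Decreasing `t` as far as possible yields a point whose exposed face contains some `(1, γ)`. -/
theorem exists_sub_mem_SDP_one_cons_mem (Q : QCQP n m) (hdef : Q.DualStrictlyFeasible)
    (hpoly : IsPolyhedralCone Q.Gam) {p : (Fin n → ℝ) × ℝ} (hp : p ∈ Q.SDP) :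
    ∃ s : ℝ, 0 ≤ s ∧ (p.1, p.2 - s) ∈ Q.SDP ∧
      ∃ γ : Fin m → ℝ, one_cons γ ∈ exposedFace Q.Gam (Q.slack p.1 (p.2 - s)) := by
  obtain ⟨γ, hγ⟩ := Q.exists_one_cons_mem_Gam hdef
  have hdown : ∀ s : ℝ, p + s • ((0, -1) : (Fin n → ℝ) × ℝ) = (p.1, p.2 - s) := fun s =>
    Prod.ext (by simp) (by simp [sub_eq_add_neg])
  have hbdd : BddAbove {α : ℝ | p + α • ((0, -1) : (Fin n → ℝ) × ℝ) ∈ Q.SDP} := by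
    refine Q.bddAbove_of_dotProduct hdef hγ (Or.inr ⟨?_, ?_⟩)
    · simp [dotProduct_slackQuad]
    · simp [dotProduct_slackLin, one_cons_zero]
  obtain ⟨s, hs, hmem, hlast⟩ := Q.exists_last_mem_SDP hdef hp hbdd
  rw [hdown] at hmem
  refine ⟨s, hs, hmem, ?_⟩
  by_contra! hcon
  obtain ⟨ε, hε, h⟩ := Q.exists_slack_sub_mem_polarCone hpoly ((Q.mem_SDP_iff hdef).1 hmem) hcon
  refine hlast ε hε ?_
  rw [hdown, Q.mem_SDP_iff hdef, ← sub_sub]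
  exact h

theorem mem_segment_add_smul_sub_smul {E : Type*} [AddCommGroup E] [Module ℝ E] (p d : E)
    {α β : ℝ} (hα : 0 ≤ α) (hβ : 0 ≤ β) : p ∈ segment ℝ (p + α • d) (p + β • -d) := by
  rcases (add_nonneg hα hβ).eq_or_lt with h | h
  · have hα0 : α = 0 := by linarith
    rw [hα0, zero_smul, add_zero]
    exact left_mem_segment ℝ _ _
  · refine ⟨β / (α + β), α / (α + β), by positivity, by positivity, ?_, ?_⟩
    · rw [← add_div, add_comm β, div_self h.ne']
    · have h1 : β / (α + β) + α / (α + β) = 1 := by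
        rw [← add_div, add_comm β, div_self h.ne']
      have h2 : β / (α + β) * α = α / (α + β) * β := by ring
      calc (β / (α + β)) • (p + α • d) + (α / (α + β)) • (p + β • -d)
          = (β / (α + β) + α / (α + β)) • p +
            (β / (α + β) * α - α / (α + β) * β) • d := by module
        _ = p := by rw [h1, h2, sub_self, zero_smul, one_smul, add_zero]

theorem mem_convexHull_S_of_one_cons_mem (Q : QCQP n m) (hdef : Q.DualStrictlyFeasible)
    (hpoly : IsPolyhedralCone Q.Gam)
    (hD : ∀ p ∈ Q.SDP \ Q.S, ∀ f : Fin m → ℝ,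
      one_cons f ∈ intrinsicInterior ℝ
        (exposedFace Q.Gam (Q.slack p.1 p.2) : Set (Fin (m + 1) → ℝ)) →
      Q.faceDirections (exposedFace Q.Gam (Q.slack p.1 p.2)) f ≠ {0})
    {p : (Fin n → ℝ) × ℝ} (hp : p ∈ Q.SDP)
    (htight : ∃ γ : Fin m → ℝ, one_cons γ ∈ exposedFace Q.Gam (Q.slack p.1 p.2)) :
    p ∈ convexHull ℝ Q.S := by
  induction hV : Submodule.span ℝ
      (exposedFace Q.Gam (Q.slack p.1 p.2) : Set (Fin (m + 1) → ℝ))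
    using WellFoundedGT.induction generalizing p with
  | ind V ih =>
  by_cases hpS : p ∈ Q.S
  · exact subset_convexHull ℝ Q.S hpS
  obtain ⟨γ, hγ⟩ := htight
  have hFle := Q.exposedFace_le (Q.slack p.1 p.2)
  obtain ⟨f, hf⟩ := exists_one_cons_mem_intrinsicInterior _ (fun y hy => (hFle hy).1 0) hγ
  have hdir := fun d => Q.mem_faceDirections_iff hFle hf p.1 (d := d)
  have hzero : (0 : (Fin n → ℝ) × ℝ) ∈ Q.faceDirections (exposedFace Q.Gam (Q.slack p.1 p.2)) f :=
    ⟨by simp, fun _ _ => by simp⟩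
  obtain ⟨d, hd, hd0⟩ : ∃ d ∈ Q.faceDirections (exposedFace Q.Gam (Q.slack p.1 p.2)) f,
      d ≠ 0 := by
    by_contra! hcon
    exact hD p ⟨hp, hpS⟩ f hf
      (Set.Subset.antisymm (fun d hd => hcon d hd) (Set.singleton_subset_iff.2 hzero))
  -- The equation for `(1, γ)` makes `t'` a function of `x'`, so a vertical direction would be zero.
  have hd1 : d.1 ≠ 0 := by
    intro h
    have h2 := hd.2 γ hγ
    rw [h, dotProduct_zero, zero_sub, neg_eq_zero] at h2
    exact hd0 (Prod.ext h h2)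
  have hdn : -d ∈ Q.faceDirections (exposedFace Q.Gam (Q.slack p.1 p.2)) f := by
    refine ⟨by rw [Prod.fst_neg, mulVec_neg, hd.1, neg_zero], fun δ hδ => ?_⟩
    have := hd.2 δ hδ
    rw [Prod.fst_neg, Prod.snd_neg, dotProduct_neg]
    linarith
  have hend : ∀ e ∈ Q.faceDirections (exposedFace Q.Gam (Q.slack p.1 p.2)) f, e.1 ≠ 0 →
      ∃ α : ℝ, 0 ≤ α ∧ p + α • e ∈ convexHull ℝ Q.S := by
    intro e he he1
    obtain ⟨α, hα, hmem, hlt⟩ :=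
      Q.exists_mem_SDP_exposedFace_lt hdef hpoly hp he1 ((hdir e).1 he)
    exact ⟨α, hα, ih _ (hV ▸ span_exposedFace_lt hlt) hmem ⟨γ, hlt.le hγ⟩ rfl⟩
  obtain ⟨α, hα, h1⟩ := hend d hd hd1
  obtain ⟨β, hβ, h2⟩ := hend (-d) hdn (neg_ne_zero.2 hd1)
  exact (convex_convexHull ℝ Q.S).segment_subset h1 h2 (mem_segment_add_smul_sub_smul p d hα hβ)

theorem convexHull_S_eq_SDP_of_faceDirections_ne (Q : QCQP n m) (hdef : Q.DualStrictlyFeasible)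
    (hpoly : IsPolyhedralCone Q.Gam)
    (hD : ∀ p ∈ Q.SDP \ Q.S, ∀ f : Fin m → ℝ,
      one_cons f ∈ intrinsicInterior ℝ
        (exposedFace Q.Gam (Q.slack p.1 p.2) : Set (Fin (m + 1) → ℝ)) →
      Q.faceDirections (exposedFace Q.Gam (Q.slack p.1 p.2)) f ≠ {0}) :
    convexHull ℝ Q.S = Q.SDP := by
  refine (convexHull_min Q.S_subset_SDP (Q.convex_SDP hdef)).antisymm fun p hp => ?_
  obtain ⟨s, hs, hmem, htight⟩ := Q.exists_sub_mem_SDP_one_cons_mem hdef hpoly hp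
  have h := Q.add_mem_convexHull_S
    (Q.mem_convexHull_S_of_one_cons_mem hdef hpoly hD hmem htight) hs
  convert h using 1
  exact Prod.ext (by simp) (by simp)

theorem faceDirections_ne_of_convexHull_S_eq_SDP (Q : QCQP n m) (hdef : Q.DualStrictlyFeasible)
    (hconv : convexHull ℝ Q.S = Q.SDP) {p : (Fin n → ℝ) × ℝ} (hp : p ∈ Q.SDP \ Q.S)
    {f : Fin m → ℝ} (hf : one_cons f ∈ intrinsicInterior ℝ
      (exposedFace Q.Gam (Q.slack p.1 p.2) : Set (Fin (m + 1) → ℝ))) :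
    Q.faceDirections (exposedFace Q.Gam (Q.slack p.1 p.2)) f ≠ {0} := by
  have hext : p ∉ (convexHull ℝ Q.S).extremePoints ℝ := fun h =>
    hp.2 (extremePoints_convexHull_subset h)
  rw [hconv, mem_extremePoints] at hext
  push Not at hext
  obtain ⟨u, hu, v, hv, ⟨a, b, ha, hb, hab, hpuv⟩, hne⟩ := hext hp.1
  -- If one endpoint of the open segment equals `p`, so does the other.
  have hup : u ≠ p := by
    intro h
    refine hne h ?_
    have h1 : b • v = b • p := by
      have h2 : a • u + b • v = a • p + b • p := by rw [hpuv, ← add_smul, hab, one_smul]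
      rwa [h, add_right_inj] at h2
    exact smul_right_injective _ hb.ne' h1
  have hu' : u = p + (1 : ℝ) • (u - p) := by module
  have hv' : v = p + (-(a / b)) • (u - p) := by
    have h1 : b • v = b • (p + (-(a / b)) • (u - p)) := by
      have h2 : b • (p + (-(a / b)) • (u - p)) = (b + b * (a / b)) • p - (b * (a / b)) • u := by
        module
      rw [h2, mul_div_cancel₀ _ hb.ne', add_comm b, hab, one_smul, ← hpuv]; module
    exact smul_right_injective _ hb.ne' h1
  have hmem : u - p ∈ Q.faceDirections (exposedFace Q.Gam (Q.slack p.1 p.2)) f := by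
    rw [Q.mem_faceDirections_iff (Q.exposedFace_le _) hf p.1]
    intro γ hγ
    obtain ⟨hγΓ, hγ0⟩ := mem_exposedFace.1 hγ
    rw [dotProduct_comm] at hγ0
    rw [Q.mem_SDP_iff hdef, mem_polarCone] at hu hv
    have h1 := hu γ hγΓ
    have h2 := hv γ hγΓ
    rw [hu', dotProduct_slack_add_smul, hγ0] at h1
    rw [hv', dotProduct_slack_add_smul, hγ0] at h2
    have h3 := Q.dotProduct_slackQuad_nonneg hγΓ (u - p)
    have hr : 0 < a / b := div_pos ha hb
    generalize a / b = r at h2 hr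
    generalize γ ⬝ᵥ Q.slackLin p.1 (u - p) = l at *
    generalize γ ⬝ᵥ Q.slackQuad (u - p) = w at *
    -- The two endpoints give `l + w ≤ 0` and `-r l + r² w ≤ 0`, so `r w ≤ l ≤ -w`; with `w ≥ 0` and
    -- `r > 0` both coefficients vanish.
    have h4 : r * w ≤ l := by
      by_contra! hlt
      nlinarith
    have h5 : w = 0 := by nlinarith
    subst h5
    constructor <;> linarith
  intro h
  rw [h] at hmem
  exact hup (sub_eq_zero.1 hmem)

end QCQP

theorem mainTheorem3 (n m : ℕ) (Q : QCQP n m) (hdef : Q.DualStrictlyFeasible)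
    (hpoly : IsPolyhedralCone Q.Gam) :
    (∀ (x : Fin n → ℝ) (t : ℝ), (x, t) ∈ Q.SDP → Q.EpigraphTight x t →
      (∃ f : Fin m → ℝ, QCQP.one_cons f ∈
        intrinsicInterior ℝ (Q.faceF x t : Set (Fin (m + 1) → ℝ))) ∧
      ∀ f : Fin m → ℝ,
        QCQP.one_cons f ∈ intrinsicInterior ℝ (Q.faceF x t : Set (Fin (m + 1) → ℝ)) →
        Q.R' x t = Q.faceDirections (Q.faceF x t) f) ∧
    (convexHull ℝ Q.S = Q.SDP ↔
      ∀ F : PointedCone ℝ (Fin (m + 1) → ℝ),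
        (∃ (x : Fin n → ℝ) (t : ℝ), (x, t) ∈ Q.SDP \ Q.S ∧
          IsFaceExposedBy F Q.Gam (Q.slack x t)) →
        ∀ f : Fin m → ℝ,
          QCQP.one_cons f ∈ intrinsicInterior ℝ (F : Set (Fin (m + 1) → ℝ)) →
          Q.faceDirections F f ≠ {0}) := by
  refine ⟨fun x t hxt ht => ?_, fun hconv => ?_, fun hD => ?_⟩
  · have hpol := (Q.mem_SDP_iff hdef).1 hxt
    have hF : Q.faceF x t = exposedFace Q.Gam (Q.slack x t) := conjugateFace_minimalFace hpol
    rw [hF]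
    obtain ⟨γ, hγ⟩ := ht.exists_mem_exposedFace hpoly hpol
    exact ⟨exists_one_cons_mem_intrinsicInterior _ (fun y hy => (Q.exposedFace_le _ hy).1 0) hγ,
      fun f hf => Q.R'_eq_faceDirections hpoly hpol hf⟩
  · rintro F ⟨x, t, hxt, -, -, hF⟩ f hf
    obtain rfl : F = exposedFace Q.Gam (Q.slack x t) :=
      SetLike.coe_injective (hF.trans (Set.ext fun y => mem_exposedFace.symm))
    exact Q.faceDirections_ne_of_convexHull_S_eq_SDP hdef hconv hxt hf
  · exact Q.convexHull_S_eq_SDP_of_faceDirections_ne hdef hpoly fun p hp f hf =>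
      hD _ ⟨p.1, p.2, hp, isFaceExposedBy_exposedFace ((Q.mem_SDP_iff hdef).1 hp.1)⟩ f hf
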